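/- Let $\mathbb{H}$ be the quaternions and $\mathbb{S}=\{I\in\mathbb{H}: I^2=-1\}$. For $\Omega\subseteq\mathbb{H}$ and $I\in\mathbb{S}$ put $\Omega_I=\Omega\cap(\mathbb{R}+I\mathbb{R})$. A function $f$ on an open set $\Omega$ is \emph{regular} if, for every $I\in\mathbb{S}$, the restriction $f_I=f|_{\Omega_I}$ has continuous partial derivatives and $\frac12\left(\frac{\partial}{\partial x}+I\frac{\partial}{\partial y}\right)f_I(x+Iy)=0$ on $\Omega_I$. A set $T\subseteq\mathbb{H}$ is \emph{symmetric} if $x+Iy\in T$ ($x,y\in\mathbb{R}$, $I\in\mathbb{S}$) implies $x+Jy\in T$ for all $J\in\mathbb{S}$. A \emph{symmetric slice domain} is a symmetric domain $\Omega\subseteq\mathbb{H}$ that meets $\mathbb{R}$ and such that $\Omega_I$ is a domain of $\mathbb{R}+I\mathbb{R}$ for every $I\in\mathbb{S}$. For $p,q\in\mathbb{H}$ lying on a common complex line $\mathbb{R}+I\mathbb{R}$ set $\sigma(q,p)=\tau(q,p)=|q-p|$; otherwise set $$\sigma(q,p)=\sqrt{(\mathrm{Re}\,q-\mathrm{Re}\,p)^2+(|\mathrm{Im}\,q|+|\mathrm{Im}\,p|)^2},\qquad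 \tau(q,p)=\sqrt{(\mathrm{Re}\,q-\mathrm{Re}\,p)^2+(|\mathrm{Im}\,q|-|\mathrm{Im}\,p|)^2}.$$ Let $\Sigma(p,0,R)=\{q:\tau(q,p)>0,\ \sigma(q,p)<R\}$. For $f,g$ regular on a symmetric slice domain, choose $I,J\in\mathbb{S}$ with $I\perp J$ and write $f_I=F+GJ$, $g_I=H+KJ$ with $F,G,H,K$ valued in $\mathbb{R}+I\mathbb{R}$. The $*$-product $f*g$ is the regular function whose restriction to $\mathbb{R}+I\mathbb{R}$ is $$\left[F(z)H(z)-G(z)\overline{K(\bar z)}\right]+\left[F(z)K(z)+G(z)\overline{H(\bar z)}\right]J,$$ the conjugate $f^c$ is the regular function whose restriction is $\overline{F(\bar z)}-G(z)J$, and $f^s=f*f^c$, $f^{-*}=(f^s)^{-1}f^c$. Let $(q-p)^{*n}$, $n\ge0$, be the $n$-th $*$-power of $q\mapsto q-p$, and let $(q-p)^{*(-m)}$ be the reciprocal $f^{-*}$ of $f(q)=(q-p)^{*m}$ (on the complex line through $p$ it is the ordinary power $(q-p)^{-m}$). A point $p\in\mathbb{H}$ is a \emph{singularity} of a regular function $f$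 on $\Omega$ if $\Sigma(p,0,R)\subseteq\Omega$ for some $R>0$. In that case $f$ has a Laurent expansion $f(q)=\sum_{n\in\mathbb{Z}}(q-p)^{*n}a_n$ on $\Sigma(p,0,R)$, with $a_n\in\mathbb{H}$. The point $p$ is a \emph{pole} if there is $m\ge0$ with $a_{-k}=0$ for all $k>m$, and an \emph{essential singularity} otherwise. \textbf{Theorem (Casorati--Weierstrass).} \begin{enumerate} \item Let $\Omega$ be a symmetric slice domain and let $f$ be a regular function on $\Omega$. If $p\in\mathbb{H}$ is an essential singularity of $f$ and $U$ is a symmetric neighborhood of $p$ in $\mathbb{H}$, then $f(\Omega\cap U)$ is dense in $\mathbb{H}$. \item Let $p\in\mathbb{R}$, $R>0$, and let $f$ be a regular function on $B(p,R)\setminus\{p\}$, where $B(p,R)=\{q\in\mathbb{H}:|q-p|<R\}$. If $f$ has an essential singularity at $p$, then for every (not necessarily symmetric) neighborhood $U$ of $p$ in $B(p,R)$ the set $f(U\setminus\{p\})$ is dense in $\mathbb{H}$. \end{enumerate} -/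

import Mathlib

open scoped Quaternion Topology

namespace SliceRegular

/-- The 2-sphere of imaginary units of `ℍ`. -/
def imagUnits : Set ℍ := {I | I * I = -1}

/-- The point `x + y I` of the complex line `ℝ + I ℝ`, where `z = x + i y`. -/
noncomputable def sliceMap (I : ℍ) (z : ℂ) : ℍ := (z.re : ℍ) + (z.im : ℍ) * I

/-- `Ω_I = Ω ∩ (ℝ + I ℝ)`, read in the coordinate `z = x + i y` of the complex line. -/
noncomputable def sliceSet (Ω : Set ℍ) (I : ℍ) : Set ℂ := sliceMap I ⁻¹' Ω

/-- `f_I` is holomorphic on `Ω_I` (an open set): it is of class `C¹` in the real variables `x, y`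
and `(1/2) (∂/∂x + I ∂/∂y) f (x + I y) = 0`. -/
def IsSliceHolomorphic (f : ℍ → ℍ) (Ω : Set ℍ) (I : ℍ) : Prop :=
  ContDiffOn ℝ 1 (fun z : ℂ => f (sliceMap I z)) (sliceSet Ω I) ∧
  ∀ z ∈ sliceSet Ω I,
    (1 / 2 : ℝ) • (fderiv ℝ (fun w : ℂ => f (sliceMap I w)) z 1 +
      I * fderiv ℝ (fun w : ℂ => f (sliceMap I w)) z Complex.I) = 0

/-- `f` is (slice) regular on the open set `Ω`. Only the values of `f` on `Ω` matter. -/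
def IsRegularOn (f : ℍ → ℍ) (Ω : Set ℍ) : Prop :=
  ∀ I ∈ imagUnits, IsSliceHolomorphic f Ω I

/-- A domain that meets the real axis and whose intersection with every complex line `ℝ + I ℝ`
is a domain of that line. -/
structure IsSliceDomain (Ω : Set ℍ) : Prop where
  isOpen : IsOpen Ω
  isConnected : IsConnected Ω
  meets_real : ∃ r : ℝ, (r : ℍ) ∈ Ω
  slice_isOpen : ∀ I ∈ imagUnits, IsOpen (sliceSet Ω I)
  slice_isConnected : ∀ I ∈ imagUnits, IsConnected (sliceSet Ω I)

/-- Axially symmetric sets. -/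
def IsAxiallySymmetric (T : Set ℍ) : Prop :=
  ∀ I ∈ imagUnits, ∀ J ∈ imagUnits, ∀ z : ℂ, sliceMap I z ∈ T → sliceMap J z ∈ T

/-- Symmetric slice domains. -/
def IsSymmetricSliceDomain (Ω : Set ℍ) : Prop :=
  IsSliceDomain Ω ∧ IsAxiallySymmetric Ω

/-- `p` and `q` lie on the same complex line `ℝ + I ℝ`. -/
def SameSlice (p q : ℍ) : Prop :=
  ∃ I ∈ imagUnits, p ∈ Set.range (sliceMap I) ∧ q ∈ Set.range (sliceMap I)

open Classical in
/-- The distance `σ`. -/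
noncomputable def sigma (q p : ℍ) : ℝ :=
  if SameSlice p q then ‖q - p‖
  else Real.sqrt ((q.re - p.re) ^ 2 + (‖q.im‖ + ‖p.im‖) ^ 2)

open Classical in
/-- The function `τ`. -/
noncomputable def tau (q p : ℍ) : ℝ :=
  if SameSlice p q then ‖q - p‖
  else Real.sqrt ((q.re - p.re) ^ 2 + (‖q.im‖ - ‖p.im‖) ^ 2)

/-- The set `Σ(p, R₁, R₂)`. -/
def shell (p : ℍ) (R₁ R₂ : ℝ) : Set ℍ := {q | R₁ < tau q p ∧ sigma q p < R₂}

open Classical in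
/-- An imaginary unit `I` with `q ∈ ℝ + I ℝ`; it is `Im q / |Im q|` if `q` is not real, and the
quaternion `i` if `q` is real. -/
noncomputable def unitOf (q : ℍ) : ℍ :=
  if q.im = 0 then ⟨0, 1, 0, 0⟩ else (‖q.im‖⁻¹ : ℝ) • q.im

/-- If `w = F + G J` with `F, G ∈ ℝ + I ℝ` and `J ⊥ I`, this is the summand `F`
(see `parPart_of_splitting`). -/
noncomputable def parPart (I w : ℍ) : ℍ := (1 / 2 : ℝ) • (w - I * w * I)

/-- If `w = F + G J` with `F, G ∈ ℝ + I ℝ` and `J ⊥ I`, this is the summand `G J`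
(see `perpPart_of_splitting`). -/
noncomputable def perpPart (I w : ℍ) : ℍ := (1 / 2 : ℝ) • (w + I * w * I)

theorem parPart_of_splitting {I J F G : ℍ} (hI : I * I = -1) (hJ : I * J = -(J * I))
    (hF : F * I = I * F) (hG : G * I = I * G) : parPart I (F + G * J) = F := by
  have h : I * (F + G * J) * I = -F + G * J := by
    calc I * (F + G * J) * I = I * (F * I) + I * G * (J * I) := by noncomm_ring
      _ = I * (I * F) + (G * I) * (-(I * J)) := by rw [hF, ← hG, hJ, neg_neg]
      _ = (I * I) * F - G * (I * I) * J := by noncomm_ring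
      _ = -F + G * J := by rw [hI]; noncomm_ring
  rw [parPart, h, show F + G * J - (-F + G * J) = (2 : ℝ) • F by rw [two_smul]; abel, smul_smul]
  norm_num

theorem perpPart_of_splitting {I J F G : ℍ} (hI : I * I = -1) (hJ : I * J = -(J * I))
    (hF : F * I = I * F) (hG : G * I = I * G) : perpPart I (F + G * J) = G * J := by
  have h : perpPart I (F + G * J) = F + G * J - parPart I (F + G * J) := by
    rw [perpPart, parPart]; module
  rw [h, parPart_of_splitting hI hJ hF hG]; abel

/-- The `*`-product of two regular functions on a symmetric slice domain. If `q = z ∈ ℝ + I ℝ`,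
`f_I = F + G J` and `g_I = H + K J` are split along `J ⊥ I`, the value is
`[F(z) H(z) - G(z) conj(K(conj z))] + [F(z) K(z) + G(z) conj(H(conj z))] J`, that is
`F(z) g(z) + G(z) J g(conj z)` (see `starMul_of_splitting`). -/
noncomputable def starMul (f g : ℍ → ℍ) (q : ℍ) : ℍ :=
  parPart (unitOf q) (f q) * g q + perpPart (unitOf q) (f q) * g (star q)

/-- The defining formula of the `*`-product on the complex line through `q`; here `H', K'` are the
components of `g` at the conjugate point `star q`. -/
theorem starMul_of_splitting {f g : ℍ → ℍ} {q J F G H K H' K' : ℍ}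
    (hI : unitOf q * unitOf q = -1) (hJJ : J * J = -1) (hJ : unitOf q * J = -(J * unitOf q))
    (hF : F * unitOf q = unitOf q * F) (hG : G * unitOf q = unitOf q * G)
    (hH' : J * H' = star H' * J) (hK' : J * K' = star K' * J)
    (hf : f q = F + G * J) (hg : g q = H + K * J) (hg' : g (star q) = H' + K' * J) :
    starMul f g q = (F * H - G * star K') + (F * K + G * star H') * J := by
  rw [starMul, hf, hg, hg', parPart_of_splitting hI hJ hF hG, perpPart_of_splitting hI hJ hF hG]
  have h : G * J * (H' + K' * J) = G * star H' * J - G * star K' := by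
    calc G * J * (H' + K' * J) = G * (J * H') + G * (J * K') * J := by noncomm_ring
      _ = G * star H' * J + G * star K' * (J * J) := by rw [hH', hK']; noncomm_ring
      _ = G * star H' * J - G * star K' := by rw [hJJ]; noncomm_ring
  rw [h]; noncomm_ring

/-- The regular conjugate: with `f_I = F + G J` as above, the value at `z ∈ ℝ + I ℝ` is
`conj(F(conj z)) - G(z) J`. -/
noncomputable def regConj (f : ℍ → ℍ) (q : ℍ) : ℍ :=
  star (parPart (unitOf q) (f (star q))) - perpPart (unitOf q) (f q)

/-- The symmetrization `f * f^c`. -/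
noncomputable def symmetrization (f : ℍ → ℍ) : ℍ → ℍ := starMul f (regConj f)

/-- The regular reciprocal `f^{-*} = (1 / f^s) f^c`, meaningful where `f^s` does not vanish. -/
noncomputable def regRecip (f : ℍ → ℍ) (q : ℍ) : ℍ :=
  (symmetrization f q)⁻¹ * regConj f q

/-- `(q - p)^{*n}`, the `n`-th `*`-power of `q ↦ q - p`, for a natural number `n`. -/
noncomputable def starPowNat (p : ℍ) : ℕ → ℍ → ℍ
  | 0 => fun _ => 1
  | n + 1 => starMul (starPowNat p n) (fun q => q - p)

open Classical in
/-- `(q - p)^{*n}` for an integer `n`: for `n = -m < 0` it is the regular reciprocal of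
`(q - p)^{*m}`. On the complex line through `p` the latter is the ordinary power `(q - p)^{-m}`;
writing it so on that line also gives it its value at the conjugate of a non-real `p`, where the
quotient that defines the reciprocal has to be read as a limit along the line. -/
noncomputable def starPow (p : ℍ) : ℤ → ℍ → ℍ
  | Int.ofNat n => starPowNat p n
  | Int.negSucc k => fun q =>
      if SameSlice p q then ((q - p) ^ (k + 1))⁻¹ else regRecip (starPowNat p (k + 1)) q

/-- `f(q) = ∑ (q - p)^{*n} a_n`, summed over the integers, on the set `Σ(p, 0, R)`. -/
def HasLaurentExpansion (f : ℍ → ℍ) (p : ℍ) (R : ℝ) (a : ℤ → ℍ) : Prop :=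
  ∀ q ∈ shell p 0 R, HasSum (fun n : ℤ => starPow p n q * a n) (f q)

/-- `p` is a singularity for a regular function on `Ω`. -/
def IsSingularity (Ω : Set ℍ) (p : ℍ) : Prop := ∃ R : ℝ, 0 < R ∧ shell p 0 R ⊆ Ω

/-- `p` is a pole (possibly of order `0`) for the regular function `f` on `Ω`: in the Laurent
expansion of `f` at `p` all but finitely many coefficients of negative index vanish. -/
def IsPoleAt (f : ℍ → ℍ) (Ω : Set ℍ) (p : ℍ) : Prop :=
  ∃ R : ℝ, 0 < R ∧ shell p 0 R ⊆ Ω ∧ ∃ a : ℤ → ℍ, HasLaurentExpansion f p R a ∧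
    ∃ m : ℕ, ∀ k : ℕ, m < k → a (-(k : ℤ)) = 0

/-- `p` is an essential singularity for the regular function `f` on `Ω`: a singularity that is not
a pole. -/
def IsEssentialSingularity (f : ℍ → ℍ) (Ω : Set ℍ) (p : ℍ) : Prop :=
  IsSingularity Ω p ∧ ¬ IsPoleAt f Ω p

end SliceRegular

open SliceRegular

open SliceRegular

namespace SliceRegular

open Filter Set

/-! ### Imaginary units and the complex lines `ℝ + I ℝ` -/

/-! Suppose the values of `f` on `Ω ∩ U` stay at distance at least `ε` from some `v`. Fix a line `ℝ
+ I ℝ` through `p`. By the representation formula (`stem_representation`), `f (x + y K) = α + K β`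
for all units `K`, where `α`, `β` depend only on `f` along that line and satisfy the Cauchy-Riemann
equations. With `a = α - v` and `b = β`, the complex number `N = |a|² - |b|² + 2i⟨a, b⟩` is
therefore holomorphic in `z = x + i y`, and `|N|` is the product of the minimum and the maximum of
`|a + K b|` over the sphere of units `K`.

By the symmetry of `U` the minimum is at least `ε` near `p`, hence `|N| ≥ ε²` and `|f - v| ≤ |N| /
ε` (`le_norm_stemNorm`). Thus `1/N` and `(f - v)/N` are bounded near `p`, so `f` is meromorphic at
`p` along the line (`meromorphicAt_slice`) and its Laurent series there has finitely many negative
terms.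

That series is the expansion required of a pole (`isPoleAt_of_le_norm_sub`). For non-real `p` a
small shell lies inside the line through `p`; for real `p` the representation formula, applied to
`f` and to every term, carries the series to all other lines. -/

theorem re_of_mem_imagUnits {I : ℍ} (hI : I ∈ imagUnits) : I.re = 0 := by
  have h : I * I = -1 := hI
  have h0 := congrArg QuaternionAlgebra.re h
  have h1 := congrArg QuaternionAlgebra.imI h
  have h2 := congrArg QuaternionAlgebra.imJ h
  have h3 := congrArg QuaternionAlgebra.imK h
  simp only [Quaternion.re_mul, Quaternion.imI_mul, Quaternion.imJ_mul, Quaternion.imK_mul,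
    Quaternion.re_neg, Quaternion.imI_neg, Quaternion.imJ_neg, Quaternion.imK_neg,
    Quaternion.re_one, Quaternion.imI_one, Quaternion.imJ_one, Quaternion.imK_one] at h0 h1 h2 h3
  by_contra hne
  have e1 : I.imI = 0 := by
    have : I.re * I.imI = 0 := by linarith
    exact (mul_eq_zero.1 this).resolve_left hne
  have e2 : I.imJ = 0 := by
    have : I.re * I.imJ = 0 := by linarith
    exact (mul_eq_zero.1 this).resolve_left hne
  have e3 : I.imK = 0 := by
    have : I.re * I.imK = 0 := by linarith
    exact (mul_eq_zero.1 this).resolve_left hne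
  rw [e1, e2, e3] at h0
  nlinarith [sq_nonneg I.re]

theorem norm_of_mem_imagUnits {I : ℍ} (hI : I ∈ imagUnits) : ‖I‖ = 1 := by
  have h : ‖I‖ * ‖I‖ = 1 := by
    rw [← norm_mul, show I * I = -1 from hI, norm_neg, norm_one]
  nlinarith [norm_nonneg I]

theorem neg_mem_imagUnits {I : ℍ} (hI : I ∈ imagUnits) : -I ∈ imagUnits := by
  change -I * -I = -1
  rw [neg_mul_neg]; exact hI

theorem mem_imagUnits_of_re_eq_zero {I : ℍ} (h0 : I.re = 0) (h1 : ‖I‖ = 1) :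
    I ∈ imagUnits := by
  have hs : star I = -I := by ext <;> simp [h0]
  have h2 : I * star I = 1 := by
    rw [Quaternion.self_mul_star, Quaternion.normSq_eq_norm_mul_self, h1]; simp
  change I * I = -1
  rw [← h2, hs, mul_neg, neg_neg]

theorem unitOf_of_im_ne_zero {q : ℍ} (h : q.im ≠ 0) : unitOf q = (‖q.im‖⁻¹ : ℝ) • q.im :=
  if_neg h

theorem unitOf_mem_imagUnits (q : ℍ) : unitOf q ∈ imagUnits := by
  by_cases h : q.im = 0
  · obtain ⟨J, hJ, e0, e1, e2, e3⟩ : ∃ J : ℍ, unitOf q = J ∧ J.re = 0 ∧ J.imI = 1 ∧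
        J.imJ = 0 ∧ J.imK = 0 := ⟨⟨0, 1, 0, 0⟩, if_pos h, rfl, rfl, rfl, rfl⟩
    rw [hJ]
    refine mem_imagUnits_of_re_eq_zero e0 ?_
    rw [← sq_eq_sq₀ (norm_nonneg _) zero_le_one, sq, ← Quaternion.normSq_eq_norm_mul_self,
      Quaternion.normSq_def', e0, e1, e2, e3]
    norm_num
  · rw [unitOf_of_im_ne_zero h]
    refine mem_imagUnits_of_re_eq_zero (by simp) ?_
    rw [norm_smul, norm_inv, norm_norm, inv_mul_cancel₀ (norm_ne_zero_iff.2 h)]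

/-- The complex line `ℝ + I ℝ` as the image of an algebra homomorphism. -/
theorem sliceMap_eq_liftAux {I : ℍ} (hI : I * I = -1) (z : ℂ) :
    sliceMap I z = Complex.liftAux I hI z := by
  rw [sliceMap, Complex.liftAux_apply, Quaternion.coe_mul_eq_smul]; rfl

theorem sliceMap_unitOf (q : ℍ) : sliceMap (unitOf q) ⟨q.re, ‖q.im‖⟩ = q := by
  rw [sliceMap, Quaternion.coe_mul_eq_smul]
  by_cases h : q.im = 0
  · rw [h, norm_zero, zero_smul, ← h, Quaternion.re_add_im]
  · rw [unitOf_of_im_ne_zero h, smul_smul, mul_inv_cancel₀ (norm_ne_zero_iff.2 h), one_smul,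
      Quaternion.re_add_im]

theorem sliceMap_conj (I : ℍ) (z : ℂ) : sliceMap I (star z) = sliceMap (-I) z := by
  simp [sliceMap]

theorem sliceMap_ofReal (I : ℍ) (r : ℝ) : sliceMap I r = (r : ℍ) := by
  simp [sliceMap]

theorem sliceMap_sub (I : ℍ) (z w : ℂ) : sliceMap I (z - w) = sliceMap I z - sliceMap I w := by
  simp only [sliceMap, Complex.sub_re, Complex.sub_im, Quaternion.coe_sub]; noncomm_ring

theorem norm_sliceMap {I : ℍ} (hI : I ∈ imagUnits) (z : ℂ) : ‖sliceMap I z‖ = ‖z‖ := by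
  have h : ‖sliceMap I z‖ * ‖sliceMap I z‖ = ‖z‖ * ‖z‖ := by
    have h1 := norm_of_mem_imagUnits hI
    have h2 : Quaternion.normSq I = 1 := by rw [Quaternion.normSq_eq_norm_mul_self, h1, one_mul]
    have h3 := re_of_mem_imagUnits hI
    rw [← Quaternion.normSq_eq_norm_mul_self, Complex.norm_mul_self_eq_normSq,
      Complex.normSq_apply]
    rw [Quaternion.normSq_def'] at h2 ⊢
    simp only [sliceMap, Quaternion.re_add, Quaternion.imI_add, Quaternion.imJ_add,
      Quaternion.imK_add, Quaternion.re_coe, Quaternion.imI_coe, Quaternion.imJ_coe,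
      Quaternion.imK_coe, Quaternion.coe_mul_eq_smul, Quaternion.re_smul, Quaternion.imI_smul,
      Quaternion.imJ_smul, Quaternion.imK_smul, smul_eq_mul, h3]
    rw [h3] at h2
    linear_combination z.im ^ 2 * h2
  exact (mul_self_inj (norm_nonneg _) (norm_nonneg _)).1 h

theorem im_sliceMap {I : ℍ} (hI : I ∈ imagUnits) (z : ℂ) : (sliceMap I z).im = z.im • I := by
  ext <;> simp [sliceMap, Quaternion.coe_mul_eq_smul, re_of_mem_imagUnits hI]

theorem continuous_sliceMap {I : ℍ} (hI : I ∈ imagUnits) : Continuous (sliceMap I) := by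
  have : Isometry (sliceMap I) := Isometry.of_dist_eq fun z w => by
    rw [dist_eq_norm, dist_eq_norm, ← sliceMap_sub, norm_sliceMap hI]
  exact this.continuous

/-- Left multiplication by `ℝ + I ℝ` makes `ℍ` a complex normed space. -/
@[reducible] noncomputable def sliceNormedSpace (I : ℍ) (hI : I ∈ imagUnits) :
    NormedSpace ℂ ℍ :=
  { Module.compHom ℍ (Complex.liftAux I hI : ℂ →ₐ[ℝ] ℍ).toRingHom with
    norm_smul_le := fun z w => by
      change ‖Complex.liftAux I hI z * w‖ ≤ _
      rw [norm_mul, ← sliceMap_eq_liftAux hI, norm_sliceMap hI] }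

theorem sliceNormedSpace_smul {I : ℍ} (hI : I ∈ imagUnits) (z : ℂ) (w : ℍ) :
    letI := sliceNormedSpace I hI
    z • w = sliceMap I z * w := by
  rw [sliceMap_eq_liftAux hI]; rfl

/-- The Cauchy-Riemann equation makes `L` complex linear when `i` acts as left multiplication by
`I`. Holomorphic function theory with values in a complex Banach space then applies on each line. -/
theorem differentiableAt_of_cauchyRiemann {I : ℍ} (hI : I ∈ imagUnits) {g : ℂ → ℍ}
    {L : ℂ →L[ℝ] ℍ} {z : ℂ} (h : HasFDerivAt g L z) (hL : L Complex.I = I * L 1) :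
    letI := sliceNormedSpace I hI
    DifferentiableAt ℂ g z := by
  let := sliceNormedSpace I hI
  have key : ∀ w : ℂ, L w = w • L 1 := fun w => by
    rw [sliceNormedSpace_smul hI, sliceMap]
    conv_lhs => rw [show w = w.re • (1 : ℂ) + w.im • Complex.I by
      apply Complex.ext <;> simp]
    rw [map_add, map_smul, map_smul, hL, Quaternion.coe_mul_eq_smul, add_mul, smul_mul_assoc,
      Quaternion.coe_mul_eq_smul]
  have : HasDerivAt g (L 1) z := by
    rw [hasDerivAt_iff_isLittleO]
    simpa only [← key] using hasFDerivAt_iff_isLittleO.1 h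
  exact this.differentiableAt

/-! ### Meromorphic functions with values in a complex Banach space -/

section Meromorphic

variable {E : Type*} [NormedAddCommGroup E] [NormedSpace ℂ E]

/-- Some `(z - p)^m • g` is analytic; dividing its Taylor series by `(z - p)^m` shifts the indices
by `m`. -/
theorem exists_hasSum_of_meromorphicAt {g : ℂ → E} {p : ℂ} (hg : MeromorphicAt g p) :
    ∃ (r : ℝ) (m : ℕ) (a : ℤ → E), 0 < r ∧ (∀ n : ℤ, n < -m → a n = 0) ∧
      ∀ z, z ≠ p → ‖z - p‖ < r → HasSum (fun n : ℤ => (z - p) ^ n • a n) (g z) := by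
  obtain ⟨m, φ, s, hφ⟩ := hg
  obtain ⟨r, hr, hrs⟩ : ∃ r : ℝ, 0 < r ∧ ENNReal.ofReal r ≤ s := by
    obtain ⟨r, hr0, hr⟩ := ENNReal.lt_iff_exists_nnreal_btwn.1 hφ.r_pos
    exact ⟨r, by exact_mod_cast hr0, by simpa using hr.le⟩
  refine ⟨r, m, fun n => if n < -m then 0 else φ.coeff (n + m).toNat, hr,
    fun n hn => if_pos hn, fun z hz hzr => ?_⟩
  have hmem : z ∈ Metric.eball p s := by
    refine Metric.eball_subset_eball hrs ?_
    rw [Metric.eball_ofReal, Metric.mem_ball, dist_eq_norm]; exact hzr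
  have h1 := hφ.hasSum_sub hmem
  have hz0 : z - p ≠ 0 := sub_ne_zero.2 hz
  have h2 := h1.const_smul (((z - p) ^ m)⁻¹)
  rw [smul_smul, inv_mul_cancel₀ (pow_ne_zero _ hz0), one_smul] at h2
  have hinj : Function.Injective (fun k : ℕ => (k : ℤ) - m) := fun a b h => by
    simpa using h
  refine (hinj.hasSum_iff ?_).1 ?_
  · intro n hn
    have : n < -m := by
      by_contra hlt
      exact hn ⟨(n + m).toNat, by simp only; omega⟩
    simp [this]
  · convert h2 using 2 with k
    have hk : ¬ ((k : ℤ) - m < -m) := by omega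
    simp only [Function.comp_apply, if_neg hk, sub_add_cancel, Int.toNat_natCast,
      FormalMultilinearSeries.apply_eq_pow_smul_coeff, smul_smul]
    rw [zpow_sub₀ hz0, zpow_natCast, zpow_natCast, div_eq_inv_mul]

variable [CompleteSpace E]

/-- The factor `(z - p)^1` forces the value and the limit at `p` to be `0` whatever `g p` is, so the
removable singularity theorem applies without redefining `g`. -/
theorem meromorphicAt_of_norm_le {g : ℂ → E} {p : ℂ} {C : ℝ}
    (hd : ∀ᶠ z in 𝓝[≠] p, DifferentiableAt ℂ g z) (hb : ∀ᶠ z in 𝓝[≠] p, ‖g z‖ ≤ C) :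
    MeromorphicAt g p := by
  refine ⟨1, Complex.analyticAt_of_differentiable_on_punctured_nhds_of_continuousAt ?_ ?_⟩
  · filter_upwards [hd] with z hz
    exact ((differentiableAt_id.sub_const p).pow 1).smul hz
  · rw [continuousAt_iff_punctured_nhds]
    simp only [pow_one, sub_self, zero_smul]
    refine squeeze_zero_norm' (a := fun z => ‖z - p‖ * C) ?_ ?_
    · filter_upwards [hb] with z hz
      rw [norm_smul]; gcongr
    · have : ContinuousAt (fun z => ‖z - p‖ * C) p := by fun_prop
      simpa [ContinuousAt] using this.tendsto.mono_left (nhdsWithin_le_nhds (s := {p}ᶜ))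

/-- If a scalar function is bounded away from zero near `p` and dominates `g`, then `g` has at
most a pole at `p`. -/
theorem meromorphicAt_of_norm_le_norm {g : ℂ → E} {N : ℂ → ℂ} {p : ℂ} {δ C : ℝ} (hδ : 0 < δ)
    (hg : ∀ᶠ z in 𝓝[≠] p, DifferentiableAt ℂ g z)
    (hN : ∀ᶠ z in 𝓝[≠] p, DifferentiableAt ℂ N z)
    (hlow : ∀ᶠ z in 𝓝[≠] p, δ ≤ ‖N z‖) (hup : ∀ᶠ z in 𝓝[≠] p, ‖g z‖ ≤ C * ‖N z‖) :
    MeromorphicAt g p := by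
  have hne : ∀ᶠ z in 𝓝[≠] p, N z ≠ 0 := by
    filter_upwards [hlow] with z hz h0
    rw [h0, norm_zero] at hz; linarith
  have h1 : MeromorphicAt N⁻¹ p := by
    refine meromorphicAt_of_norm_le (C := δ⁻¹) ?_ ?_
    · filter_upwards [hN, hne] with z hz h0 using hz.inv h0
    · filter_upwards [hlow] with z hz
      rw [Pi.inv_apply, norm_inv]; gcongr
  have h2 : MeromorphicAt (fun z => (N z)⁻¹ • g z) p := by
    refine meromorphicAt_of_norm_le (C := C) ?_ ?_
    · filter_upwards [hN, hne, hg] with z hz h0 h3 using (hz.inv h0).smul h3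
    · filter_upwards [hne, hup] with z h0 hz
      rw [norm_smul, norm_inv, inv_mul_le_iff₀ (norm_pos_iff.2 h0), mul_comm]; exact hz
  refine ((MeromorphicAt.inv_iff.1 h1).smul h2).congr ?_
  filter_upwards [hne] with z h0
  simp [smul_smul, h0]

end Meromorphic

/-! ### Stem functions and the representation formula -/

/-- The function `α` in the representation `f (x + y K) = α + K β`. -/
noncomputable def stemRe (f : ℍ → ℍ) (I : ℍ) (z : ℂ) : ℍ :=
  (1 / 2 : ℝ) • (f (sliceMap I z) + f (sliceMap I (star z)))

/-- The function `β` in the representation `f (x + y K) = α + K β`. -/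
noncomputable def stemIm (f : ℍ → ℍ) (I : ℍ) (z : ℂ) : ℍ :=
  (1 / 2 : ℝ) • (I * (f (sliceMap I (star z)) - f (sliceMap I z)))

/-- The Cauchy-Riemann equations for a pair of functions `α`, `β` with values in `ℍ`. -/
def IsStemAt (α β : ℂ → ℍ) (z : ℂ) : Prop :=
  ∃ A B : ℂ →L[ℝ] ℍ, HasFDerivAt α A z ∧ HasFDerivAt β B z ∧
    A Complex.I = -B 1 ∧ B Complex.I = A 1

theorem IsAxiallySymmetric.mem_sliceSet {T : Set ℍ} (hT : IsAxiallySymmetric T) {I J : ℍ}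
    (hI : I ∈ imagUnits) (hJ : J ∈ imagUnits) {z : ℂ} (hz : z ∈ sliceSet T I) :
    z ∈ sliceSet T J := hT I hI J hJ z hz

theorem IsAxiallySymmetric.star_mem_sliceSet {T : Set ℍ} (hT : IsAxiallySymmetric T) {I : ℍ}
    (hI : I ∈ imagUnits) {z : ℂ} (hz : z ∈ sliceSet T I) : star z ∈ sliceSet T I := by
  change sliceMap I (star z) ∈ T
  rw [sliceMap_conj]
  exact hT I hI _ (neg_mem_imagUnits hI) z hz

theorem IsSliceHolomorphic.exists_hasFDerivAt {f : ℍ → ℍ} {Ω : Set ℍ} {I : ℍ}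
    (hI : I ∈ imagUnits) (hf : IsSliceHolomorphic f Ω I) (ho : IsOpen (sliceSet Ω I)) {z : ℂ}
    (hz : z ∈ sliceSet Ω I) :
    ∃ L : ℂ →L[ℝ] ℍ, HasFDerivAt (fun w => f (sliceMap I w)) L z ∧ L Complex.I = I * L 1 := by
  have hd := (hf.1.contDiffAt (ho.mem_nhds hz)).differentiableAt one_ne_zero
  refine ⟨_, hd.hasFDerivAt, ?_⟩
  have h := (smul_eq_zero.1 (hf.2 z hz)).resolve_left (by norm_num)
  rw [eq_neg_of_add_eq_zero_left h, mul_neg, ← mul_assoc, show I * I = -1 from hI]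
  simp

theorem isStemAt_stem {f : ℍ → ℍ} {Ω : Set ℍ} {I : ℍ} (hs : IsAxiallySymmetric Ω)
    (hI : I ∈ imagUnits) (hf : IsSliceHolomorphic f Ω I) (ho : IsOpen (sliceSet Ω I)) {z : ℂ}
    (hz : z ∈ sliceSet Ω I) : IsStemAt (stemRe f I) (stemIm f I) z := by
  obtain ⟨L, hL, hL'⟩ := hf.exists_hasFDerivAt hI ho hz
  obtain ⟨M, hM, hM'⟩ := hf.exists_hasFDerivAt hI ho (hs.star_mem_sliceSet hI hz)
  have hMc : HasFDerivAt (fun w => f (sliceMap I (star w)))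
      (M.comp (Complex.conjCLE : ℂ →L[ℝ] ℂ)) z :=
    HasFDerivAt.comp z hM (Complex.conjCLE : ℂ →L[ℝ] ℂ).hasFDerivAt
  have hII : I * I = -1 := hI
  refine ⟨(1 / 2 : ℝ) • (L + M.comp (Complex.conjCLE : ℂ →L[ℝ] ℂ)),
    (1 / 2 : ℝ) • ((ContinuousLinearMap.mul ℝ ℍ I).comp
      (M.comp (Complex.conjCLE : ℂ →L[ℝ] ℂ) - L)), (hL.add hMc).const_smul (1 / 2 : ℝ),
    ((ContinuousLinearMap.mul ℝ ℍ I).hasFDerivAt.comp z (hMc.sub hL)).const_smul (1 / 2 : ℝ), ?_, ?_⟩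
  · simp [hL', hM', ← smul_neg, sub_eq_add_neg]
  · simp [hL', hM', ← mul_assoc, hII, add_comm]

theorem IsStemAt.sub_const {α β : ℂ → ℍ} {z : ℂ} (h : IsStemAt α β z) (v : ℍ) :
    IsStemAt (fun w => α w - v) β z := by
  obtain ⟨A, B, hA, hB, h1, h2⟩ := h
  exact ⟨A, B, hA.sub_const v, hB, h1, h2⟩

/-- The equations on `α`, `β` do not mention a unit, so one pair yields a holomorphic function on
every line. -/
theorem IsStemAt.differentiableAt {α β : ℂ → ℍ} {z : ℂ} (h : IsStemAt α β z) {K : ℍ}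
    (hK : K ∈ imagUnits) :
    letI := sliceNormedSpace K hK
    DifferentiableAt ℂ (fun w => α w + K * β w) z := by
  obtain ⟨A, B, hA, hB, h1, h2⟩ := h
  have hKK : K * K = -1 := hK
  refine differentiableAt_of_cauchyRiemann hK
    (hA.add ((ContinuousLinearMap.mul ℝ ℍ K).hasFDerivAt.comp z hB)) ?_
  simp [h1, h2, mul_add, ← mul_assoc, hKK, add_comm]

/-- Both sides are holomorphic on the line of `K` and agree at real points, where `β` vanishes; the
identity theorem does the rest. -/
theorem stem_representation {f : ℍ → ℍ} {Ω : Set ℍ} (hs : IsAxiallySymmetric Ω)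
    (ho : ∀ I ∈ imagUnits, IsOpen (sliceSet Ω I))
    (hc : ∀ I ∈ imagUnits, IsPreconnected (sliceSet Ω I)) (hr : ∃ r : ℝ, (r : ℍ) ∈ Ω)
    (hf : IsRegularOn f Ω) {I K : ℍ} (hI : I ∈ imagUnits) (hK : K ∈ imagUnits) {z : ℂ}
    (hz : z ∈ sliceSet Ω K) : f (sliceMap K z) = stemRe f I z + K * stemIm f I z := by
  let := sliceNormedSpace K hK
  have h1 : AnalyticOnNhd ℂ (fun w => f (sliceMap K w)) (sliceSet Ω K) := by
    refine DifferentiableOn.analyticOnNhd (fun w hw => ?_) (ho K hK)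
    obtain ⟨L, hL, hL'⟩ := (hf K hK).exists_hasFDerivAt hK (ho K hK) hw
    exact (differentiableAt_of_cauchyRiemann hK hL hL').differentiableWithinAt
  have h2 : AnalyticOnNhd ℂ (fun w => stemRe f I w + K * stemIm f I w) (sliceSet Ω K) := by
    refine DifferentiableOn.analyticOnNhd (fun w hw => ?_) (ho K hK)
    exact ((isStemAt_stem hs hI (hf I hI) (ho I hI)
      (hs.mem_sliceSet hK hI hw)).differentiableAt hK).differentiableWithinAt
  obtain ⟨r, hr⟩ := hr
  refine h1.eqOn_of_preconnected_of_frequently_eq h2 (hc K hK) (z₀ := (r : ℂ)) ?_ ?_ hz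
  · change sliceMap K r ∈ Ω
    rwa [sliceMap_ofReal]
  · have ht : Tendsto (fun x : ℝ => (x : ℂ)) (𝓝[≠] r) (𝓝[≠] (r : ℂ)) :=
      tendsto_nhdsWithin_of_tendsto_nhds_of_eventually_within _
        (Complex.continuous_ofReal.continuousAt.tendsto.mono_left nhdsWithin_le_nhds)
        (by filter_upwards [self_mem_nhdsWithin] with x hx using by simpa using hx)
    refine ht.frequently (Frequently.of_forall fun x => ?_)
    have hx : star (x : ℂ) = x := Complex.conj_ofReal x
    simp only [stemRe, stemIm, hx, sliceMap_ofReal, sub_self, mul_zero, smul_zero, add_zero,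
      ← two_smul ℝ (f x), smul_smul]
    norm_num

/-! ### The complexified norm of a stem function -/

/-- The complex number `|α + i β|²` obtained by extending the quadratic form `|α|²` to
`ℍ ⊗ ℂ`. -/
noncomputable def stemNorm (a b : ℍ) : ℂ :=
  ((inner ℝ a a - inner ℝ b b : ℝ) : ℂ) + ((2 * inner ℝ a b : ℝ) : ℂ) * Complex.I

/-- `α + i β` is holomorphic with values in `ℍ ⊗ ℂ`, and `stemNorm` is a complex quadratic form in
it, with no conjugation of `i`. -/
theorem IsStemAt.differentiableAt_stemNorm {α β : ℂ → ℍ} {z : ℂ} (h : IsStemAt α β z) :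
    DifferentiableAt ℂ (fun w => stemNorm (α w) (β w)) z := by
  obtain ⟨A, B, hA, hB, h1, h2⟩ := h
  have hd := (Complex.ofRealCLM.hasFDerivAt.comp z ((hA.inner ℝ hA).sub (hB.inner ℝ hB))).add
    ((Complex.ofRealCLM.hasFDerivAt.comp z ((hA.inner ℝ hB).const_mul 2)).mul_const Complex.I)
  have hd' : HasFDerivAt (fun w => stemNorm (α w) (β w)) _ z := hd
  rw [differentiableAt_complex_iff_differentiableAt_real]
  refine ⟨hd'.differentiableAt, ?_⟩
  rw [hd'.fderiv]
  apply Complex.ext <;>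
    simp [h1, h2, inner_neg_left, inner_neg_right, real_inner_comm] <;> ring

theorem norm_add_mul_sq {K : ℍ} (hK : K ∈ imagUnits) (a b : ℍ) :
    ‖a + K * b‖ ^ 2 = ‖a‖ ^ 2 + ‖b‖ ^ 2 + 2 * inner ℝ (a * star b).im K := by
  have h0 := re_of_mem_imagUnits hK
  rw [norm_add_sq_real, norm_mul, norm_of_mem_imagUnits hK, one_mul]
  have : inner ℝ a (K * b) = inner ℝ (a * star b).im K := by
    simp only [Quaternion.inner_def, star_mul, ← mul_assoc]
    simp [Quaternion.re_mul, h0]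
  rw [this]; ring

theorem norm_im_mul_star_sq (a b : ℍ) :
    ‖(a * star b).im‖ ^ 2 = ‖a‖ ^ 2 * ‖b‖ ^ 2 - inner ℝ a b ^ 2 := by
  have h : ‖a * star b‖ ^ 2 = (a * star b).re ^ 2 + ‖(a * star b).im‖ ^ 2 := by
    simp only [sq ‖_‖, ← Quaternion.normSq_eq_norm_mul_self, Quaternion.normSq_def']
    simp
    ring
  rw [norm_mul, norm_star, mul_pow] at h
  rw [Quaternion.inner_def]; linarith

theorem norm_stemNorm_sq (a b : ℍ) :
    ‖stemNorm a b‖ ^ 2 = (‖a‖ ^ 2 + ‖b‖ ^ 2) ^ 2 - (2 * ‖(a * star b).im‖) ^ 2 := by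
  rw [mul_pow, norm_im_mul_star_sq, Complex.sq_norm, Complex.normSq_apply]
  simp only [stemNorm, Complex.add_re, Complex.add_im,
    Complex.re_ofReal_mul, Complex.im_ofReal_mul, Complex.ofReal_re, Complex.ofReal_im,
    Complex.I_re, Complex.I_im, real_inner_self_eq_norm_sq]
  ring

/-- With `s = |a|² + |b|²` and `m = Im (a * star b)`, the extreme values of `|a + K b|²` are `s -
2|m|` and `s + 2|m|`, and their product is `|stemNorm a b|²`. -/
theorem le_norm_stemNorm {a b : ℍ} {ε : ℝ} (hε : 0 < ε)
    (h : ∀ K ∈ imagUnits, ε ≤ ‖a + K * b‖) :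
    ε ^ 2 ≤ ‖stemNorm a b‖ ∧ ∀ K ∈ imagUnits, ‖a + K * b‖ ≤ ε⁻¹ * ‖stemNorm a b‖ := by
  have hN := norm_stemNorm_sq a b
  set m := (a * star b).im with hm
  have hmin : ε ^ 2 ≤ ‖a‖ ^ 2 + ‖b‖ ^ 2 - 2 * ‖m‖ := by
    by_cases h0 : m = 0
    · have hK := unitOf_mem_imagUnits 0
      have h1 := pow_le_pow_left₀ hε.le (h _ hK) 2
      rw [norm_add_mul_sq hK, ← hm, h0, inner_zero_left] at h1
      rw [h0, norm_zero]; linarith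
    · have hn := norm_ne_zero_iff.2 h0
      -- The minimum is attained at the unit opposite to `m`.
      have hK : -(‖m‖⁻¹ • m) ∈ imagUnits := by
        refine mem_imagUnits_of_re_eq_zero (by simp [hm]) ?_
        rw [norm_neg, norm_smul, norm_inv, norm_norm, inv_mul_cancel₀ hn]
      have h1 := pow_le_pow_left₀ hε.le (h _ hK) 2
      rw [norm_add_mul_sq hK, ← hm, inner_neg_right, inner_smul_right,
        real_inner_self_eq_norm_mul_norm, inv_mul_cancel_left₀ hn] at h1
      linarith
  have hm0 := norm_nonneg m
  have hε2 : 0 < ε ^ 2 := by positivity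
  constructor
  · refine (sq_le_sq₀ (by positivity) (norm_nonneg _)).1 ?_
    rw [hN]; nlinarith
  · intro K hK
    have hmax : ‖a + K * b‖ ^ 2 ≤ ‖a‖ ^ 2 + ‖b‖ ^ 2 + 2 * ‖m‖ := by
      have := real_inner_le_norm m K
      rw [norm_of_mem_imagUnits hK, mul_one] at this
      rw [norm_add_mul_sq hK]; linarith
    rw [le_inv_mul_iff₀ hε]
    refine (sq_le_sq₀ (by positivity) (norm_nonneg _)).1 ?_
    rw [hN, mul_pow]
    calc ε ^ 2 * ‖a + K * b‖ ^ 2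
        ≤ (‖a‖ ^ 2 + ‖b‖ ^ 2 - 2 * ‖m‖) * (‖a‖ ^ 2 + ‖b‖ ^ 2 + 2 * ‖m‖) :=
          mul_le_mul hmin hmax (by positivity) (by linarith)
      _ = _ := by ring

/-! ### Powers of `q - p` on the complex line through `p` -/

theorem sliceMap_zpow {I : ℍ} (hI : I ∈ imagUnits) (z : ℂ) (n : ℤ) :
    sliceMap I (z ^ n) = sliceMap I z ^ n := by
  rw [sliceMap_eq_liftAux hI, sliceMap_eq_liftAux hI, map_zpow₀]

theorem commute_unitOf {p q : ℍ} (h : SameSlice p q) (hq : q.im ≠ 0) :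
    Commute (unitOf q) (q - p) := by
  obtain ⟨K, hK, ⟨z, rfl⟩, ⟨w, rfl⟩⟩ := h
  rw [unitOf_of_im_ne_zero hq, im_sliceMap hK, ← sliceMap_sub, sliceMap,
    Quaternion.coe_mul_eq_smul]
  have h1 : Commute K (((w - z).re : ℝ) : ℍ) := (Quaternion.coe_commute _ K).symm
  exact ((h1.add_right ((Commute.refl K).smul_right _)).smul_left _).smul_left _

theorem starPowNat_of_sameSlice {p q : ℍ} (h : SameSlice p q) (n : ℕ) :
    starPowNat p n q = (q - p) ^ n := by
  induction n with
  | zero => rfl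
  | succ n ih =>
    rw [starPowNat, starMul, ih, pow_succ]
    -- At a real `q`, `unitOf q` is the quaternion `i`, which need not commute with `q - p`; there
    -- `star q = q`, and the two parts recombine.
    by_cases hq : q.im = 0
    · have hs : star q = q := by
        rw [Quaternion.star_eq_self, ← Quaternion.re_add_im q, hq]; simp
      rw [hs, ← add_mul, parPart, perpPart, ← smul_add, sub_add_add_cancel, ← two_smul ℝ, smul_smul]
      norm_num
    · have hc : Commute (unitOf q) ((q - p) ^ n) := (commute_unitOf h hq).pow_right n
      have hu : unitOf q * unitOf q = -1 := unitOf_mem_imagUnits q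
      have h0 := parPart_of_splitting (I := unitOf q) (J := 0) (G := 0) hu (by simp) hc.eq.symm
        (by simp)
      have h1 := perpPart_of_splitting (I := unitOf q) (J := 0) (G := 0) hu (by simp) hc.eq.symm
        (by simp)
      rw [mul_zero, add_zero] at h0 h1
      rw [h0, h1, zero_mul, add_zero]

theorem starPow_of_sameSlice {p q : ℍ} (h : SameSlice p q) (n : ℤ) :
    starPow p n q = (q - p) ^ n := by
  cases n with
  | ofNat n => rw [starPow, starPowNat_of_sameSlice h, Int.ofNat_eq_natCast, zpow_natCast]
  | negSucc k => exact (if_pos h).trans (zpow_negSucc _ _).symm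

theorem starPow_sliceMap {I : ℍ} (hI : I ∈ imagUnits) (w z : ℂ) (n : ℤ) :
    starPow (sliceMap I z) n (sliceMap I w) = sliceMap I ((w - z) ^ n) := by
  rw [starPow_of_sameSlice ⟨I, hI, ⟨z, rfl⟩, ⟨w, rfl⟩⟩, sliceMap_zpow hI, sliceMap_sub]

theorem sliceMap_mem_shell_iff {I : ℍ} (hI : I ∈ imagUnits) (w z : ℂ) (R : ℝ) :
    sliceMap I w ∈ shell (sliceMap I z) 0 R ↔ w ≠ z ∧ ‖w - z‖ < R := by
  have h : SameSlice (sliceMap I z) (sliceMap I w) := ⟨I, hI, ⟨z, rfl⟩, ⟨w, rfl⟩⟩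
  rw [shell, mem_ofPred_eq, tau, sigma, if_pos h, if_pos h, ← sliceMap_sub, norm_sliceMap hI,
    norm_pos_iff, sub_ne_zero]

/-- Off the lines through `p`, `sigma q p` is at least `|Im q| + |Im p| ≥ |Im p|`. -/
theorem sameSlice_of_mem_shell {p q : ℍ} {R : ℝ} (hR : R ≤ ‖p.im‖) (hq : q ∈ shell p 0 R) :
    SameSlice p q := by
  by_contra h
  have h2 := hq.2
  rw [sigma, if_neg h] at h2
  refine absurd (h2.trans_le hR) (not_lt.2 (Real.le_sqrt_of_sq_le ?_))
  nlinarith [norm_nonneg q.im, norm_nonneg p.im, sq_nonneg (q.re - p.re)]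

theorem exists_sliceMap_eq_of_sameSlice {I : ℍ} (hI : I ∈ imagUnits) {z : ℂ} (hz : z.im ≠ 0)
    {q : ℍ} (h : SameSlice (sliceMap I z) q) : ∃ w, sliceMap I w = q := by
  obtain ⟨K, hK, ⟨z', hz'⟩, ⟨w, rfl⟩⟩ := h
  have him := congrArg QuaternionAlgebra.im hz'
  replace him : z'.im • K = z.im • I := by rw [← im_sliceMap hK, ← im_sliceMap hI]; exact him
  have h0 : z'.im ≠ 0 := by
    intro h0
    rw [h0, zero_smul] at him
    have hn := congrArg norm him
    rw [norm_zero, norm_smul, norm_of_mem_imagUnits hI, mul_one] at hn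
    exact hz (norm_eq_zero.1 hn.symm)
  have hK' : K = (z'.im⁻¹ * z.im) • I := by rw [← smul_smul, ← him, inv_smul_smul₀ h0]
  refine ⟨⟨w.re, w.im * (z'.im⁻¹ * z.im)⟩, ?_⟩
  simp only [sliceMap, Quaternion.coe_mul_eq_smul]
  rw [hK', smul_smul]

/-! ### Behaviour of a regular function whose image near a singularity is not dense -/

/-- The properties of a symmetric slice domain that the representation formula uses. -/
structure HasSymmetricSlices (Ω : Set ℍ) : Prop where
  symmetric : IsAxiallySymmetric Ω
  isOpen : ∀ I ∈ imagUnits, IsOpen (sliceSet Ω I)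
  isPreconnected : ∀ I ∈ imagUnits, IsPreconnected (sliceSet Ω I)
  meets_real : ∃ r : ℝ, (r : ℍ) ∈ Ω

theorem HasSymmetricSlices.stem_representation {Ω : Set ℍ} (hΩ : HasSymmetricSlices Ω) {f : ℍ → ℍ}
    (hf : IsRegularOn f Ω) {I K : ℍ} (hI : I ∈ imagUnits) (hK : K ∈ imagUnits) {z : ℂ}
    (hz : z ∈ sliceSet Ω K) : f (sliceMap K z) = stemRe f I z + K * stemIm f I z :=
  SliceRegular.stem_representation hΩ.symmetric hΩ.isOpen hΩ.isPreconnected hΩ.meets_real hf hI hK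
    hz

theorem meromorphicAt_slice {Ω U : Set ℍ} (hΩ : HasSymmetricSlices Ω) {f : ℍ → ℍ}
    (hf : IsRegularOn f Ω) (hU : IsAxiallySymmetric U) {I : ℍ} (hI : I ∈ imagUnits) {p : ℂ}
    (hΩp : ∀ᶠ z in 𝓝[≠] p, z ∈ sliceSet Ω I) (hUp : ∀ᶠ z in 𝓝[≠] p, z ∈ sliceSet U I) {v : ℍ}
    {ε : ℝ} (hε : 0 < ε) (hv : ∀ q ∈ Ω ∩ U, ε ≤ ‖f q - v‖) :
    letI := sliceNormedSpace I hI
    MeromorphicAt (fun z => f (sliceMap I z)) p := by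
  let := sliceNormedSpace I hI
  have key : ∀ᶠ z in 𝓝[≠] p, ε ^ 2 ≤ ‖stemNorm (stemRe f I z - v) (stemIm f I z)‖ ∧
      ‖f (sliceMap I z) - v‖ ≤ ε⁻¹ * ‖stemNorm (stemRe f I z - v) (stemIm f I z)‖ := by
    filter_upwards [hΩp, hUp] with z h1 h2
    have hrep : ∀ K ∈ imagUnits, f (sliceMap K z) - v = stemRe f I z - v + K * stemIm f I z := by
      intro K hK
      rw [hΩ.stem_representation hf hI hK (hΩ.symmetric.mem_sliceSet hI hK h1)]
      abel
    -- Symmetry puts every `x + y K` in `Ω ∩ U`; a lower bound along the line of `I` alone would not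
    -- control `stemNorm`.
    have h3 := le_norm_stemNorm (a := stemRe f I z - v) (b := stemIm f I z) hε fun K hK => by
      rw [← hrep K hK]
      exact hv _ ⟨hΩ.symmetric I hI K hK z h1, hU I hI K hK z h2⟩
    refine ⟨h3.1, ?_⟩
    rw [hrep I hI]
    exact h3.2 I hI
  have hd : ∀ᶠ z in 𝓝[≠] p, DifferentiableAt ℂ (fun w => f (sliceMap I w) - v) z := by
    filter_upwards [hΩp] with z hz
    obtain ⟨L, hL, hL'⟩ := (hf I hI).exists_hasFDerivAt hI (hΩ.isOpen I hI) hz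
    exact differentiableAt_of_cauchyRiemann hI (hL.sub_const v) hL'
  have hN : ∀ᶠ z in 𝓝[≠] p,
      DifferentiableAt ℂ (fun w => stemNorm (stemRe f I w - v) (stemIm f I w)) z := by
    filter_upwards [hΩp] with z hz
    exact ((isStemAt_stem hΩ.symmetric hI (hf I hI) (hΩ.isOpen I hI) hz).sub_const
      v).differentiableAt_stemNorm
  have hm := meromorphicAt_of_norm_le_norm (pow_pos hε 2) hd hN (key.mono fun _ h => h.1)
    (key.mono fun _ h => h.2)
  exact (hm.add (MeromorphicAt.const v p)).congr
    (Eventually.of_forall fun z => sub_add_cancel _ _)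

/-- This is the representation formula for a single Laurent term about a real centre, with `W` a
power of `z - p`. -/
theorem stem_sliceMap_mul {I K : ℍ} (hI : I ∈ imagUnits) (W : ℂ) (a : ℍ) :
    (1 / 2 : ℝ) • (sliceMap I W * a + sliceMap I (star W) * a) +
      K * ((1 / 2 : ℝ) • (I * (sliceMap I (star W) * a - sliceMap I W * a))) =
      sliceMap K W * a := by
  have hII : I * I = -1 := hI
  have h1 : sliceMap I W + sliceMap I (star W) = (2 : ℝ) • (W.re : ℍ) := by
    rw [sliceMap_conj, sliceMap, sliceMap, two_smul]; noncomm_ring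
  have h2 : I * (sliceMap I (star W) - sliceMap I W) = (2 : ℝ) • (W.im : ℍ) := by
    rw [sliceMap_conj, sliceMap, sliceMap,
      show (W.re : ℍ) + (W.im : ℍ) * -I - (W.re + W.im * I) = -((2 : ℝ) • ((W.im : ℍ) * I)) by
        rw [two_smul]; noncomm_ring,
      Quaternion.coe_mul_eq_smul, mul_neg, mul_smul_comm, mul_smul_comm, hII, two_smul, two_smul,
      smul_neg, neg_add, neg_neg, ← Quaternion.coe_mul_eq_smul, mul_one]
  rw [← add_mul, h1, ← sub_mul, ← mul_assoc, h2, smul_mul_assoc, smul_smul, smul_mul_assoc,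
    smul_smul]
  norm_num
  rw [sliceMap, add_mul, ← mul_assoc, Quaternion.coe_commutes W.im K, Quaternion.coe_commutes]

theorem isPoleAt_of_le_norm_sub {Ω U : Set ℍ} (hΩ : HasSymmetricSlices Ω) {f : ℍ → ℍ}
    (hf : IsRegularOn f Ω) (hU : IsAxiallySymmetric U) {p : ℍ} (hp : IsSingularity Ω p)
    (hUp : U ∈ 𝓝 p) {v : ℍ} {ε : ℝ} (hε : 0 < ε) (hv : ∀ q ∈ Ω ∩ U, ε ≤ ‖f q - v‖) :
    IsPoleAt f Ω p := by
  obtain ⟨R, hR, hshell⟩ := hp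
  have hI := unitOf_mem_imagUnits p
  have hpI := sliceMap_unitOf p
  set I := unitOf p
  set z₀ : ℂ := ⟨p.re, ‖p.im‖⟩ with hz₀
  clear_value I
  have hball : ∀ z, z ≠ z₀ → ‖z - z₀‖ < R → z ∈ sliceSet Ω I := fun z h1 h2 => by
    refine hshell ?_
    rw [← hpI, sliceMap_mem_shell_iff hI]
    exact ⟨h1, h2⟩
  have hΩp : ∀ᶠ z in 𝓝[≠] z₀, z ∈ sliceSet Ω I := by
    filter_upwards [self_mem_nhdsWithin, nhdsWithin_le_nhds (Metric.ball_mem_nhds z₀ hR)] with z h1 h2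
    exact hball z h1 (by rwa [← dist_eq_norm])
  have hUp' : ∀ᶠ z in 𝓝[≠] z₀, z ∈ sliceSet U I :=
    nhdsWithin_le_nhds ((continuous_sliceMap hI).continuousAt.preimage_mem_nhds (by rwa [hpI]))
  obtain ⟨r, m, a, hr, ha, hsum⟩ :
      ∃ (r : ℝ) (m : ℕ) (a : ℤ → ℍ), 0 < r ∧ (∀ n : ℤ, n < -m → a n = 0) ∧
        ∀ z, z ≠ z₀ → ‖z - z₀‖ < r →
          HasSum (fun n : ℤ => sliceMap I ((z - z₀) ^ n) * a n) (f (sliceMap I z)) := by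
    let := sliceNormedSpace I hI
    obtain ⟨r, m, a, hr, ha, hsum⟩ :=
      exists_hasSum_of_meromorphicAt (meromorphicAt_slice hΩ hf hU hI hΩp hUp' hε hv)
    refine ⟨r, m, a, hr, ha, fun z h1 h2 => ?_⟩
    simpa only [sliceNormedSpace_smul hI] using hsum z h1 h2
  have hpole : ∀ k : ℕ, m < k → a (-(k : ℤ)) = 0 := fun k hk => ha _ (by omega)
  have hmono : ∀ {s : ℝ}, s ≤ R → shell p 0 s ⊆ Ω := fun hs q hq =>
    hshell ⟨hq.1, hq.2.trans_le hs⟩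
  by_cases him : p.im = 0
  · have hreal : ∀ K : ℍ, sliceMap K z₀ = p := fun K => by
      have : z₀ = (p.re : ℂ) := by rw [hz₀, him, norm_zero]; rfl
      rw [this, sliceMap_ofReal]
      conv_rhs => rw [← Quaternion.re_add_im p, him, add_zero]
    have hstar : star z₀ = z₀ := by rw [hz₀, him, norm_zero]; apply Complex.ext <;> simp
    refine ⟨min r R, lt_min hr hR, hmono (min_le_right _ _), a, fun q hq => ?_, m, hpole⟩
    have hK := unitOf_mem_imagUnits q
    have hqK := sliceMap_unitOf q
    set K := unitOf q
    set w : ℂ := ⟨q.re, ‖q.im‖⟩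
    clear_value K w
    subst hqK
    have hqΩ : w ∈ sliceSet Ω K := hmono (min_le_right _ _) hq
    rw [← hreal K, sliceMap_mem_shell_iff hK] at hq
    rw [hΩ.stem_representation hf hI hK hqΩ, stemRe, stemIm]
    have hw' : star w - z₀ = star (w - z₀) := by rw [star_sub, hstar]
    -- The expansions on the line of `I` at `w` and at its conjugate combine, through the
    -- representation formula, into one at `q` on the line of `K`.
    have h1 := hsum w hq.1 (hq.2.trans_le (min_le_left _ _))
    have h2 := hsum (star w) (fun h => hq.1 (star_injective (h.trans hstar.symm)))
      (by rw [hw', norm_star]; exact hq.2.trans_le (min_le_left _ _))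
    have h3 := ((h1.add h2).const_smul (1 / 2 : ℝ)).add
      ((((h2.sub h1).mul_left I).const_smul (1 / 2 : ℝ)).mul_left K)
    convert h3 using 2 with n
    rw [← hreal K, starPow_sliceMap hK, hw', ← star_zpow₀, stem_sliceMap_mul hI]
  · have hpos : 0 < ‖p.im‖ := norm_pos_iff.2 him
    refine ⟨min (min r R) ‖p.im‖, lt_min (lt_min hr hR) hpos,
      hmono ((min_le_left _ _).trans (min_le_right _ _)), a, fun q hq => ?_, m, hpole⟩
    have hss := sameSlice_of_mem_shell (min_le_right _ _) hq
    rw [← hpI] at hss hq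
    obtain ⟨w, rfl⟩ := exists_sliceMap_eq_of_sameSlice hI (z := z₀) hpos.ne' hss
    rw [sliceMap_mem_shell_iff hI] at hq
    rw [← hpI]
    simp only [starPow_sliceMap hI]
    exact hsum w hq.1 (hq.2.trans_le ((min_le_left _ _).trans (min_le_left _ _)))

theorem dense_image_of_not_isPoleAt {Ω U : Set ℍ} (hΩ : HasSymmetricSlices Ω) {f : ℍ → ℍ}
    (hf : IsRegularOn f Ω) (hU : IsAxiallySymmetric U) {p : ℍ} (hp : IsEssentialSingularity f Ω p)
    (hUp : U ∈ 𝓝 p) : Dense (f '' (Ω ∩ U)) := by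
  by_contra hd
  obtain ⟨v, hv⟩ : ∃ v, v ∉ closure (f '' (Ω ∩ U)) := by
    simpa [Dense] using hd
  rw [Metric.mem_closure_iff] at hv
  push Not at hv
  obtain ⟨ε, hε, hv⟩ := hv
  refine hp.2 (isPoleAt_of_le_norm_sub hΩ hf hU hp.1 hUp (v := v) hε fun q hq => ?_)
  rw [← dist_eq_norm, dist_comm]
  exact hv _ (mem_image_of_mem f hq)

/-! ### Punctured balls with real centre -/

/-- The punctured disc is the image of a half-plane under `p + exp w`. -/
theorem isPreconnected_punctured_ball (p : ℂ) {R : ℝ} (hR : 0 < R) :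
    IsPreconnected {z : ℂ | ‖z - p‖ < R ∧ z ≠ p} := by
  have h : {z : ℂ | ‖z - p‖ < R ∧ z ≠ p} =
      (fun w => p + Complex.exp w) '' {w : ℂ | w.re < Real.log R} := by
    ext z
    constructor
    · rintro ⟨h1, h2⟩
      have h0 := sub_ne_zero.2 h2
      refine ⟨Complex.log (z - p), ?_, ?_⟩
      · rw [mem_ofPred_eq, Complex.log_re]
        exact Real.log_lt_log (norm_pos_iff.2 h0) h1
      · simp only [Complex.exp_log h0, add_sub_cancel]
    · rintro ⟨w, hw, rfl⟩
      refine ⟨?_, by simp⟩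
      rw [add_sub_cancel_left, Complex.norm_exp, ← Real.lt_log_iff_exp_lt hR]
      exact hw
  rw [h]
  exact (convex_halfSpace_re_lt _).isPreconnected.image _ (by fun_prop)

theorem sliceSet_punctured_ball {I : ℍ} (hI : I ∈ imagUnits) (p R : ℝ) :
    sliceSet (Metric.ball (p : ℍ) R \ {(p : ℍ)}) I = {z : ℂ | ‖z - p‖ < R ∧ z ≠ p} := by
  ext z
  have h : ‖sliceMap I z - p‖ = ‖z - p‖ := by
    rw [← sliceMap_ofReal I, ← sliceMap_sub, norm_sliceMap hI]
  rw [sliceSet, mem_preimage, Set.mem_sdiff, Metric.mem_ball, dist_eq_norm, h, mem_singleton_iff,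
    ← sub_eq_zero, ← norm_eq_zero, h, norm_eq_zero, sub_eq_zero]
  rfl

theorem isAxiallySymmetric_ball (p R : ℝ) : IsAxiallySymmetric (Metric.ball (p : ℍ) R) := by
  intro I hI J hJ z hz
  rw [Metric.mem_ball, dist_eq_norm, ← sliceMap_ofReal J, ← sliceMap_sub, norm_sliceMap hJ]
  rwa [Metric.mem_ball, dist_eq_norm, ← sliceMap_ofReal I, ← sliceMap_sub, norm_sliceMap hI] at hz

theorem hasSymmetricSlices_punctured_ball (p : ℝ) {R : ℝ} (hR : 0 < R) :
    HasSymmetricSlices (Metric.ball (p : ℍ) R \ {(p : ℍ)}) where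
  symmetric I hI J hJ z hz := by
    change z ∈ sliceSet (Metric.ball (p : ℍ) R \ {(p : ℍ)}) J
    rw [sliceSet_punctured_ball hJ, ← sliceSet_punctured_ball hI]
    exact hz
  isOpen I hI := (Metric.isOpen_ball.sdiff isClosed_singleton).preimage (continuous_sliceMap hI)
  isPreconnected I hI := by
    rw [sliceSet_punctured_ball hI]
    exact isPreconnected_punctured_ball _ hR
  meets_real := by
    refine ⟨p + R / 2, ?_, ?_⟩
    · rw [Metric.mem_ball, dist_eq_norm, ← Quaternion.coe_sub, Quaternion.norm_coe,
        add_sub_cancel_left, Real.norm_of_nonneg (by positivity)]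
      linarith
    · rw [mem_singleton_iff, Quaternion.coe_inj]
      linarith

end SliceRegular

theorem mainTheorem5 :
    (∀ (Ω : Set ℍ) (f : ℍ → ℍ) (p : ℍ) (U : Set ℍ),
      IsSymmetricSliceDomain Ω → IsRegularOn f Ω → IsEssentialSingularity f Ω p →
      IsAxiallySymmetric U → U ∈ 𝓝 p →
      Dense (f '' (Ω ∩ U))) ∧
    (∀ (p R : ℝ) (f : ℍ → ℍ) (U : Set ℍ), 0 < R →
      IsRegularOn f (Metric.ball (p : ℍ) R \ {(p : ℍ)}) →
      IsEssentialSingularity f (Metric.ball (p : ℍ) R \ {(p : ℍ)}) (p : ℍ) →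
      U ∈ 𝓝 (p : ℍ) → U ⊆ Metric.ball (p : ℍ) R →
      Dense (f '' (U \ {(p : ℍ)}))) := by
  refine ⟨fun Ω f p U hΩ hf hp hU hUp => ?_, fun p R f U hR hf hp hUp _ => ?_⟩
  · exact dense_image_of_not_isPoleAt ⟨hΩ.2, hΩ.1.slice_isOpen,
      fun I hI => (hΩ.1.slice_isConnected I hI).isPreconnected, hΩ.1.meets_real⟩ hf hU hp hUp
  -- A ball about a real point is symmetric, so any neighborhood of `p` contains a symmetric one.
  · obtain ⟨r, hr, hrU⟩ := Metric.mem_nhds_iff.1 hUp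
    refine (dense_image_of_not_isPoleAt (hasSymmetricSlices_punctured_ball p hR) hf
      (isAxiallySymmetric_ball p r) hp (Metric.ball_mem_nhds _ hr)).mono (Set.image_mono ?_)
    exact fun q hq => ⟨hrU hq.2, hq.1.2⟩
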